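/- Let $n,m$ be integers with $m\ge 1$ and $n\ge 2m$, let $\varepsilon_1\in\{-1,1\}$, and suppose that $f(x)=x^n+\varepsilon_1x^m-\varepsilon_1$ is reducible over $\mathbb{Q}$. Then $f(x)$ is divisible in $\mathbb{Q}[x]$ by $\Phi_6\bigl(x^{\gcd(n,m)}\bigr)$, where $\Phi_6(x)=x^2-x+1$ is the sixth cyclotomic polynomial. For a positive integer $k$ let $e(k)$ denote the largest power of $2$ dividing $k$, and let $b$ and, when $n\neq 2m$, $q$ be the exponents of $3$ in the prime factorizations of $m$ and $n-2m$, respectively. Moreover: (a) if $\varepsilon_1=1$, then $n>2m$, $e(m)=e(n-2m)$ and $q>b$; (b) if $\varepsilon_1=-1$ and $n>2m$, then $e(m)<e(n-2m)$ and $q>b$. -/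

import Mathlib

open Polynomial

/-- The even part of a positive integer `n`: if `n = 2 ^ a * n₁` with `n₁` odd,
then `evenPart n = 2 ^ a`. (Only used for `n > 0`.) -/
def evenPart (n : ℕ) : ℕ := 2 ^ padicValNat 2 n

/-- The trinomial `x ^ n + ε x ^ m - ε` over the rationals. -/
noncomputable def signTrinomial (n m : ℕ) (ε : ℚ) : ℚ[X] := X ^ n + C ε * X ^ m - C ε

/-! A trinomial with coefficients ±1 sharing no complex root with its reciprocal is irreducible, so
reducibility yields a common root `z`. With `d = gcd(m, n - 2m)`, `m = d a`, `n - 2m = d b`, the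
element `u = z ^ d` is then a primitive sixth root of unity with `u ^ b = -ε` and `a` prime to 6.
This gives the factor `Φ₆(X ^ d)`, and the valuation claims reduce to `b ≡ 3` or `b ≡ 0` mod 6. -/

/-- If `X ^ n + ε X ^ m - ε` is reducible over `ℚ`, then it has a complex root in common with its
reciprocal polynomial, and such a root `z` satisfies `Φ₆(z ^ m) = 0` and `z ^ (n - 2 m) = -ε`. -/
theorem exists_common_root_of_not_irreducible {n m : ℕ} (hm : 0 < m) (hnm : 2 * m ≤ n) (ε : ℤˣ)
    (hred : ¬ Irreducible (signTrinomial n m ((ε : ℤ) : ℚ))) :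
    ∃ z : ℂ, (z ^ m) ^ 2 - z ^ m + 1 = 0 ∧ z ^ (n - 2 * m) = -((ε : ℤ) : ℂ) := by
  have hmn : m < n := by omega
  have hε : ((ε : ℤ) : ℂ) * ((ε : ℤ) : ℂ) = 1 := by
    rw [← Int.cast_mul, Int.units_coe_mul_self, Int.cast_one]
  have hmap : signTrinomial n m ((ε : ℤ) : ℚ) =
      (trinomial 0 m n ((-ε : ℤˣ) : ℤ) (ε : ℤ) 1).map (Int.castRingHom ℚ) := by
    simp [trinomial, signTrinomial]
    ring
  have hnot : ¬ Irreducible (trinomial 0 m n ((-ε : ℤˣ) : ℤ) (ε : ℤ) 1) := by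
    rw [IsPrimitive.Int.irreducible_iff_irreducible_map_cast (trinomial_monic hm hmn).isPrimitive]
    rwa [hmap] at hred
  have hroot : ∃ z : ℂ, aeval z (trinomial 0 m n ((-ε : ℤˣ) : ℤ) (ε : ℤ) 1) = 0 ∧
      aeval z (trinomial 0 m n ((-ε : ℤˣ) : ℤ) (ε : ℤ) 1).mirror = 0 := by
    by_contra h
    push Not at h
    exact hnot (IsUnitTrinomial.irreducible_of_coprime' ⟨0, m, n, hm, hmn, -ε, ε, 1, rfl⟩
      fun z hz => h z hz.1 hz.2)
  obtain ⟨z, h1, h2⟩ := hroot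
  rw [trinomial_mirror hm hmn (-ε).ne_zero one_ne_zero] at h2
  simp only [trinomial, Units.val_neg, map_add, map_mul, map_pow, aeval_X, map_neg, map_one,
    eq_intCast, map_intCast, pow_zero, mul_one, one_mul, add_zero] at h1 h2
  obtain ⟨k, rfl⟩ := Nat.exists_eq_add_of_le hnm
  have e1 : 2 * m + k - m = m + k := by omega
  have e2 : 2 * m + k - 2 * m = k := by omega
  rw [e1] at h2
  rw [e2]
  set c : ℂ := ((ε : ℤ) : ℂ)
  rw [pow_add, pow_mul'] at h1
  rw [pow_add, pow_add, pow_mul'] at h2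
  set t := z ^ k
  set w := z ^ m
  have hc : c ≠ 0 := left_ne_zero_of_mul_eq_one hε
  have hw : w ≠ 0 := by
    intro h
    rw [h] at h1
    exact hc (by linear_combination -h1)
  have ht : t = -c := by
    -- Adding `c` times the first equation to the second cancels `w ^ 2 * t` and the constants.
    have h3 : w * (1 + c * t) = 0 := by linear_combination h2 + c * h1 + (1 - w) * hε
    have h4 := (mul_eq_zero.mp h3).resolve_left hw
    linear_combination c * h4 - t * hε
  refine ⟨z, ?_, ht⟩
  rw [ht] at h1
  linear_combination (-c) * h1 - (w ^ 2 - w + 1) * hε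

theorem isPrimitiveRoot_six_of_sq_sub_add_one_eq_zero {w : ℂ} (hw : w ^ 2 - w + 1 = 0) :
    IsPrimitiveRoot w 6 := by
  rw [← isRoot_cyclotomic_iff, cyclotomic_six, IsRoot.def]
  simpa using hw

/-- If `u ^ a` is a primitive sixth root of unity and `u ^ b = ± 1` with `a`, `b` coprime, then
`u` is itself a primitive sixth root of unity and `a` is prime to `6`. -/
theorem IsPrimitiveRoot.six_of_pow {u : ℂ} {a b : ℕ} (hab : a.Coprime b)
    (ha : IsPrimitiveRoot (u ^ a) 6) (hb : u ^ (2 * b) = 1) :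
    IsPrimitiveRoot u 6 ∧ a.Coprime 6 := by
  -- The order of `u` divides both `6a` and `6b`, hence 6.
  have h6 : u ^ 6 = 1 := by
    have h1 : orderOf u ∣ a * 6 := orderOf_dvd_of_pow_eq_one (by rw [pow_mul, ha.pow_eq_one])
    have h2 : orderOf u ∣ b * 6 := orderOf_dvd_of_pow_eq_one (by
      rw [show b * 6 = 2 * b * 3 by ring, pow_mul, hb, one_pow])
    have h3 := Nat.dvd_gcd h1 h2
    rw [Nat.gcd_mul_right, hab.gcd_eq_one, one_mul] at h3
    exact orderOf_dvd_iff_pow_eq_one.mp h3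
  have hu : IsPrimitiveRoot u 6 := by
    refine ⟨h6, fun l hl => ha.dvd_of_pow_eq_one l ?_⟩
    rw [← pow_mul, mul_comm, pow_mul, hl, one_pow]
  exact ⟨hu, (hu.pow_iff_coprime (by norm_num) a).mp ha⟩

/-- The substitution `X ↦ X ^ d` turns divisibility by `Φ₆` of a trinomial having a primitive sixth
root of unity as a root into divisibility by `Φ₆(X ^ d)`. -/
theorem cyclotomic_six_comp_dvd_signTrinomial {u : ℂ} (hu : IsPrimitiveRoot u 6) (a b d : ℕ)
    (ε : ℤ) (hroot : u ^ b + (ε : ℂ) * u ^ a - ε = 0) :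
    (cyclotomic 6 ℚ).comp (X ^ d) ∣ signTrinomial (d * b) (d * a) (ε : ℚ) := by
  have hdvd : cyclotomic 6 ℚ ∣ signTrinomial b a (ε : ℚ) := by
    rw [cyclotomic_eq_minpoly_rat hu (by norm_num)]
    refine minpoly.dvd ℚ u ?_
    simpa [signTrinomial] using hroot
  obtain ⟨g, hg⟩ := hdvd
  refine ⟨g.comp (X ^ d), ?_⟩
  rw [← mul_comp, ← hg]
  simp [signTrinomial, pow_mul]

theorem IsPrimitiveRoot.pow_eq_neg_one_iff_of_six {u : ℂ} (hu : IsPrimitiveRoot u 6) {k : ℕ} :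
    u ^ k = -1 ↔ 3 ∣ k ∧ ¬ 2 ∣ k := by
  have h3 : u ^ 3 = -1 := by
    have h : u ^ 3 * u ^ 3 = 1 := by rw [← pow_add, hu.pow_eq_one]
    refine (mul_self_eq_one_iff.mp h).resolve_left fun h1 => ?_
    have := hu.dvd_of_pow_eq_one 3 h1
    omega
  constructor
  · intro h
    have h2 : 6 ∣ k * 2 := hu.dvd_of_pow_eq_one _ (by rw [pow_mul, h]; norm_num)
    refine ⟨by omega, fun hk => ?_⟩
    have h6 : 6 ∣ k := by omega
    rw [(hu.pow_eq_one_iff_dvd k).mpr h6] at h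
    norm_num at h
  · rintro ⟨⟨l, rfl⟩, hl⟩
    rw [pow_mul, h3, Odd.neg_one_pow (Nat.not_even_iff_odd.mp fun h => hl (by
      have := h.two_dvd
      omega))]

theorem mainTheorem4 (n m : ℕ) (hm : 0 < m) (hnm : 2 * m ≤ n)
    (ε₁ : ℚ) (hε₁ : ε₁ = 1 ∨ ε₁ = -1)
    (hred : ¬ Irreducible (signTrinomial n m ε₁)) :
    (cyclotomic 6 ℚ).comp (X ^ Nat.gcd n m) ∣ signTrinomial n m ε₁ ∧
    (ε₁ = 1 → 2 * m < n ∧ evenPart m = evenPart (n - 2 * m) ∧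
      padicValNat 3 m < padicValNat 3 (n - 2 * m)) ∧
    (ε₁ = -1 → 2 * m < n → evenPart m < evenPart (n - 2 * m) ∧
      padicValNat 3 m < padicValNat 3 (n - 2 * m)) := by
  obtain ⟨ε, rfl⟩ : ∃ ε : ℤˣ, ε₁ = ((ε : ℤ) : ℚ) := by
    rcases hε₁ with rfl | rfl
    exacts [⟨1, by simp⟩, ⟨-1, by simp⟩]
  obtain ⟨z, hw, ht⟩ := exists_common_root_of_not_irreducible hm hnm ε hred
  obtain ⟨k, rfl⟩ := Nat.exists_eq_add_of_le hnm
  rw [Nat.add_sub_cancel_left] at ht ⊢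
  have hgcd : Nat.gcd (2 * m + k) m = Nat.gcd m k := by
    rw [Nat.gcd_comm, add_comm, Nat.gcd_add_mul_right_right]
  rw [hgcd]
  obtain ⟨d, a, b, hd, hab, rfl, rfl⟩ : ∃ d a b, 0 < d ∧ Nat.Coprime a b ∧ m = d * a ∧ k = d * b :=
    ⟨m.gcd k, m / m.gcd k, k / m.gcd k, Nat.gcd_pos_of_pos_left _ hm,
      Nat.coprime_div_gcd_div_gcd (Nat.gcd_pos_of_pos_left _ hm),
      (Nat.mul_div_cancel' (Nat.gcd_dvd_left _ _)).symm,
      (Nat.mul_div_cancel' (Nat.gcd_dvd_right _ _)).symm⟩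
  rw [Nat.gcd_mul_left, hab.gcd_eq_one, mul_one]
  rw [pow_mul] at hw ht
  generalize z ^ d = u at hw ht
  have hε2 : ((ε : ℤ) : ℂ) ^ 2 = 1 := by
    rw [sq, ← Int.cast_mul, Int.units_coe_mul_self, Int.cast_one]
  have ha6 := isPrimitiveRoot_six_of_sq_sub_add_one_eq_zero hw
  obtain ⟨hu, hcop⟩ := IsPrimitiveRoot.six_of_pow hab ha6
    (by rw [mul_comm, pow_mul, ht, neg_sq, hε2])
  have ha2 : ¬ 2 ∣ a := fun h => by
    have := Nat.dvd_gcd h (show 2 ∣ 6 by norm_num)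
    rw [hcop.gcd_eq_one] at this
    omega
  have ha3 : ¬ 3 ∣ a := fun h => by
    have := Nat.dvd_gcd h (show 3 ∣ 6 by norm_num)
    rw [hcop.gcd_eq_one] at this
    omega
  have ha0 : a ≠ 0 := by rintro rfl; simp at ha2
  -- For `p = 2, 3` only `b` can make the valuations of `m` and `n - 2m` differ.
  have hval (p : ℕ) [Fact p.Prime] (hpa : ¬ p ∣ a) : padicValNat p (d * a) = padicValNat p d := by
    rw [padicValNat.mul hd.ne' ha0, padicValNat.eq_zero_of_not_dvd hpa, add_zero]
  have hlt (p : ℕ) [Fact p.Prime] (hpa : ¬ p ∣ a) (hb0 : b ≠ 0) (hpb : p ∣ b) :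
      padicValNat p (d * a) < padicValNat p (d * b) := by
    rw [hval p hpa, padicValNat.mul hd.ne' hb0]
    have := one_le_padicValNat_of_dvd hb0 hpb
    omega
  refine ⟨?_, fun h => ?_, fun h hlt' => ?_⟩
  · rw [show 2 * (d * a) + d * b = d * (2 * a + b) by ring]
    refine cyclotomic_six_comp_dvd_signTrinomial hu a (2 * a + b) d ε ?_
    rw [pow_add, pow_mul', ht]
    linear_combination (-((ε : ℤ) : ℂ)) * hw
  · rw [show ((ε : ℤ) : ℂ) = 1 by exact_mod_cast h, hu.pow_eq_neg_one_iff_of_six] at ht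
    -- Here `b` is odd, which rules out `n = 2m`.
    have hb0 : b ≠ 0 := by rintro rfl; simp at ht
    refine ⟨by have := Nat.mul_pos hd (Nat.pos_of_ne_zero hb0); omega, ?_, hlt 3 ha3 hb0 ht.1⟩
    rw [evenPart, evenPart, hval 2 ha2, padicValNat.mul hd.ne' hb0,
      padicValNat.eq_zero_of_not_dvd ht.2, add_zero]
  · have hε : ((ε : ℤ) : ℂ) = -1 := by exact_mod_cast h
    rw [hε, neg_neg, hu.pow_eq_one_iff_dvd] at ht
    have hb0 : b ≠ 0 := by rintro rfl; simp at hlt'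
    exact ⟨Nat.pow_lt_pow_right one_lt_two
      (hlt 2 ha2 hb0 ((by norm_num : 2 ∣ 6).trans ht)),
      hlt 3 ha3 hb0 ((by norm_num : 3 ∣ 6).trans ht)⟩
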